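/- Let $k\ge 0$. A non-adaptive measurement-based quantum computation (nMBQC) with $k$ input bits and $n$ parties consists of a quantum state $\rho$ on a tensor product $\mathcal H_1\otimes\cdots\otimes\mathcal H_n$ of Hilbert spaces of arbitrary dimension, two two-outcome measurements (POVMs) $\{E^{(j),s}_0,E^{(j),s}_1\}$, $s\in\{0,1\}$, on $\mathcal H_j$ for every party $j$, a matrix $P\in\mathbb Z_2^{n\times k}$ and a vector $b\in\mathbb Z_2^n$. On the input $x\in\mathbb Z_2^k$ a control computer that can only compute XORs sends the bits $s(x)=Px\oplus b$ to the parties; in a single round party $j$ makes the measurement labelled $s_j(x)$ and returns the outcome $m_j\in\{0,1\}$, so that the outcomes are $m$ with probability $p(m|s)=\operatorname{Tr}\bigl(\rho\bigotimes_{j=1}^n E^{(j),s_j}_{m_j}\bigr)$, and the output is the parity $\bigoplus_{j=1}^n m_j$. The computation performs $f:\mathbb Z_2^k\to\mathbb Z_2$ deterministically if its mean success probability over uniformly distributed inputs is one: $$\frac1{2^k}\sum_{x\in\mathbb Z_2^k}\ \sum_{m:\ \bigoplus_j m_j=f(x)}p(m|s(x))=1 .$$ Theorem. The least number of parties with which the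 $k$-bit NAND function $f(x)=1\oplus\prod_{j=1}^k x_j$ can be performed deterministically in nMBQC is $2^k-1$: (i) there is an nMBQC with $n=2^k-1$ parties that performs it deterministically, even one with a pure state $\rho=|\psi\rangle\langle\psi|$, projective measurements, $b=0$ and no zero row in $P$; (ii) no nMBQC with $n<2^k-1$ parties performs it deterministically, whatever the state, the local Hilbert spaces, the measurements, $P$ and $b$. -/

import Mathlib

universe u

noncomputable section

open scoped ComplexConjugate ComplexOrder

namespace MBQC

/-! ### The Hilbert space tensor product of a finite family of Hilbert spaces -/

section Tensor

variable {n : ℕ}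

/-- The algebraic tensor product of the spaces `H j`. It is a type synonym, because Mathlib puts
the projective seminorm on `⨂[ℂ] j, H j`, whereas the seminorm that is needed here is the one of
the inner product with `⟪⨂ v j, ⨂ w j⟫ = ∏ j, ⟪v j, w j⟫`. -/
def AlgTensor (H : Fin n → Type u) [∀ j, NormedAddCommGroup (H j)]
    [∀ j, InnerProductSpace ℂ (H j)] : Type u :=
  PiTensorProduct ℂ H

variable (H : Fin n → Type u) [∀ j, NormedAddCommGroup (H j)] [∀ j, InnerProductSpace ℂ (H j)]

instance : AddCommGroup (AlgTensor H) := inferInstanceAs (AddCommGroup (PiTensorProduct ℂ H))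

instance : Module ℂ (AlgTensor H) := inferInstanceAs (Module ℂ (PiTensorProduct ℂ H))

variable {H}

/-- The elementary tensor `v 0 ⊗ v 1 ⊗ ⋯ ⊗ v (n - 1)`. -/
def AlgTensor.tprod (v : ∀ j, H j) : AlgTensor H := PiTensorProduct.tprod ℂ v

/-- The linear functional `⟪⨂ v j, ·⟫`. -/
def AlgTensor.functional (v : ∀ j, H j) : AlgTensor H →ₗ[ℂ] ℂ :=
  (PiTensorProduct.lift ((MultilinearMap.mkPiAlgebra ℂ (Fin n) ℂ).compLinearMap
    (fun j => innerₛₗ ℂ (v j))) : PiTensorProduct ℂ H →ₗ[ℂ] ℂ)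

theorem AlgTensor.functional_tprod (v w : ∀ j, H j) :
    AlgTensor.functional v (AlgTensor.tprod w) = ∏ j, inner ℂ (v j) (w j) := by
  unfold AlgTensor.functional AlgTensor.tprod
  erw [PiTensorProduct.lift.tprod]
  simp

theorem AlgTensor.span_tprod :
    Submodule.span ℂ (Set.range (AlgTensor.tprod : (∀ j, H j) → AlgTensor H)) = ⊤ :=
  PiTensorProduct.span_tprod_eq_top

theorem AlgTensor.exists_finsupp (x : AlgTensor H) :
    ∃ c : (∀ j, H j) →₀ ℂ, c.sum (fun v a => a • AlgTensor.tprod v) = x := by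
  have hx : x ∈ Submodule.span ℂ (Set.range (AlgTensor.tprod : (∀ j, H j) → AlgTensor H)) := by
    rw [AlgTensor.span_tprod]; trivial
  exact Finsupp.mem_span_range_iff_exists_finsupp.1 hx

theorem AlgTensor.functional_ext {f g : AlgTensor H →ₗ[ℂ] ℂ}
    (h : ∀ v, f (AlgTensor.tprod v) = g (AlgTensor.tprod v)) : f = g :=
  LinearMap.ext_on_range AlgTensor.span_tprod h

theorem AlgTensor.functional_update_add (m : ∀ j, H j) (i : Fin n) (x y : H i) :
    AlgTensor.functional (Function.update m i (x + y)) =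
      AlgTensor.functional (Function.update m i x) +
        AlgTensor.functional (Function.update m i y) := by
  refine AlgTensor.functional_ext fun v => ?_
  simp only [LinearMap.add_apply, AlgTensor.functional_tprod]
  rw [← Finset.mul_prod_erase _ _ (Finset.mem_univ i), ← Finset.mul_prod_erase _ _
    (Finset.mem_univ i), ← Finset.mul_prod_erase _ _ (Finset.mem_univ i)]
  have h : ∀ z : H i, ∏ j ∈ Finset.univ.erase i, inner ℂ (Function.update m i z j) (v j) =
      ∏ j ∈ Finset.univ.erase i, inner ℂ (m j) (v j) := fun z =>
    Finset.prod_congr rfl fun j hj => by rw [Function.update_of_ne (Finset.ne_of_mem_erase hj)]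
  simp only [h, Function.update_self, inner_add_left, add_mul]

theorem AlgTensor.functional_update_smul (m : ∀ j, H j) (i : Fin n) (a : ℂ) (x : H i) :
    AlgTensor.functional (Function.update m i (a • x)) =
      conj a • AlgTensor.functional (Function.update m i x) := by
  refine AlgTensor.functional_ext fun v => ?_
  simp only [LinearMap.smul_apply, AlgTensor.functional_tprod]
  rw [← Finset.mul_prod_erase _ _ (Finset.mem_univ i), ← Finset.mul_prod_erase _ _
    (Finset.mem_univ i)]
  have h : ∀ z : H i, ∏ j ∈ Finset.univ.erase i, inner ℂ (Function.update m i z j) (v j) =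
      ∏ j ∈ Finset.univ.erase i, inner ℂ (m j) (v j) := fun z =>
    Finset.prod_congr rfl fun j hj => by rw [Function.update_of_ne (Finset.ne_of_mem_erase hj)]
  simp only [h, Function.update_self, inner_smul_left, smul_eq_mul, mul_assoc]

/-- The form `y ↦ (x ↦ ⟪x, y⟫)`, linear in `y` and conjugate-linear in `x`, determined by
`⟪⨂ v j, ⨂ w j⟫ = ∏ j, ⟪v j, w j⟫`. -/
def AlgTensor.form : AlgTensor H →ₗ[ℂ] (AlgTensor H →ₗ⋆[ℂ] ℂ) :=
  (PiTensorProduct.lift (R := ℂ) (s := H)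
    { toFun := fun w =>
        (starLinearEquiv ℂ : ℂ ≃ₗ⋆[ℂ] ℂ).toLinearMap.comp (AlgTensor.functional w)
      map_update_add' := by
        intro inst m i x y
        rw [Subsingleton.elim inst (instDecidableEqFin n), AlgTensor.functional_update_add]
        ext z
        simp
      map_update_smul' := by
        intro inst m i a x
        rw [Subsingleton.elim inst (instDecidableEqFin n), AlgTensor.functional_update_smul]
        ext z
        simp } : PiTensorProduct ℂ H →ₗ[ℂ] (AlgTensor H →ₗ⋆[ℂ] ℂ))

theorem AlgTensor.form_tprod_left (w : ∀ j, H j) (x : AlgTensor H) :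
    AlgTensor.form (AlgTensor.tprod w) x = conj (AlgTensor.functional w x) := by
  unfold AlgTensor.form AlgTensor.tprod
  erw [PiTensorProduct.lift.tprod]
  rfl

theorem AlgTensor.form_tprod_tprod (v w : ∀ j, H j) :
    AlgTensor.form (AlgTensor.tprod w) (AlgTensor.tprod v) = ∏ j, inner ℂ (v j) (w j) := by
  rw [AlgTensor.form_tprod_left, AlgTensor.functional_tprod, map_prod]
  simp

theorem AlgTensor.form_sum (c d : (∀ j, H j) →₀ ℂ) :
    AlgTensor.form (d.sum fun v a => a • AlgTensor.tprod v)
        (c.sum fun v a => a • AlgTensor.tprod v) =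
      c.sum fun v a => d.sum fun w b => star a * (∏ j, inner ℂ (v j) (w j)) * b := by
  simp only [Finsupp.sum, map_sum, LinearMap.sum_apply, map_smul, LinearMap.smul_apply,
    LinearMap.map_smulₛₗ, AlgTensor.form_tprod_tprod, smul_eq_mul, Finset.mul_sum]
  refine Finset.sum_congr rfl fun v _ => Finset.sum_congr rfl fun w _ => ?_
  simp only [RCLike.star_def]
  ring

theorem posSemidef_gram {ι E : Type*} [NormedAddCommGroup E] [InnerProductSpace ℂ E]
    (v : ι → E) : (Matrix.gram ℂ v).PosSemidef := by
  refine ⟨Matrix.isHermitian_gram ℂ v, fun c => ?_⟩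
  have h : (c.sum fun i xi => c.sum fun j xj => star xi * Matrix.gram ℂ v i j * xj) =
      inner ℂ (c.sum fun i a => a • v i) (c.sum fun i a => a • v i) := by
    simp only [Finsupp.sum, sum_inner, inner_sum, inner_smul_left, inner_smul_right,
      Matrix.gram_apply, RCLike.star_def, Finset.mul_sum]
    rw [Finset.sum_comm]
    refine Finset.sum_congr rfl fun v _ => Finset.sum_congr rfl fun w _ => ?_
    ring
  rw [h]
  exact RCLike.nonneg_iff.2 ⟨inner_self_nonneg, inner_self_im _⟩

/-- If `0 ≤ A j ≤ B j` for all `j`, then the same holds for the entrywise products. -/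
theorem posSemidef_prod {ι : Type*} (s : Finset (Fin n)) (A B : Fin n → Matrix ι ι ℂ)
    (hA : ∀ j, (A j).PosSemidef) (hAB : ∀ j, (B j - A j).PosSemidef) :
    (Matrix.of fun v w => ∏ j ∈ s, A j v w).PosSemidef ∧
      (Matrix.of (fun v w => ∏ j ∈ s, B j v w) -
        Matrix.of fun v w => ∏ j ∈ s, A j v w).PosSemidef := by
  classical
  induction s using Finset.induction_on with
  | empty =>
    refine ⟨?_, ?_⟩
    · refine ⟨by ext; simp, fun x => ?_⟩
      have : (x.sum fun i xi => x.sum fun j xj => star xi *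
          (Matrix.of fun (v w : ι) => ∏ j ∈ (∅ : Finset (Fin n)), A j v w) i j * xj) =
          star (x.sum fun _ a => a) * x.sum fun _ a => a := by
        simp [Finsupp.sum, Finset.sum_mul_sum]
      rw [this]
      exact star_mul_self_nonneg _
    · simpa using Matrix.PosSemidef.zero
  | insert j s hj ih =>
    obtain ⟨h1, h2⟩ := ih
    refine ⟨?_, ?_⟩
    · have h : (Matrix.of fun v w => ∏ j ∈ insert j s, A j v w) =
          (A j).hadamard (Matrix.of fun v w => ∏ j ∈ s, A j v w) := by
        ext v w
        simp [Finset.prod_insert hj]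
      rw [h]
      exact (hA j).hadamard h1
    · have hB : (B j).PosSemidef := by
        have := (hAB j).add (hA j)
        rwa [sub_add_cancel] at this
      have h : (Matrix.of (fun v w => ∏ j ∈ insert j s, B j v w) -
          Matrix.of fun v w => ∏ j ∈ insert j s, A j v w) =
          (B j).hadamard (Matrix.of (fun v w => ∏ j ∈ s, B j v w) -
            Matrix.of fun v w => ∏ j ∈ s, A j v w) +
          (B j - A j).hadamard (Matrix.of fun v w => ∏ j ∈ s, A j v w) := by
        ext v w
        simp [Finset.prod_insert hj]
        ring
      rw [h]
      exact (hB.hadamard h2).add ((hAB j).hadamard h1)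

variable (H) in
/-- The inner product on the algebraic tensor product, with
`⟪⨂ v j, ⨂ w j⟫ = ∏ j, ⟪v j, w j⟫`. -/
@[reducible]
def AlgTensor.core : PreInnerProductSpace.Core ℂ (AlgTensor H) where
  inner x y := AlgTensor.form y x
  conj_inner_symm x y := by
    obtain ⟨c, rfl⟩ := AlgTensor.exists_finsupp x
    obtain ⟨d, rfl⟩ := AlgTensor.exists_finsupp y
    rw [AlgTensor.form_sum, AlgTensor.form_sum]
    simp only [Finsupp.sum, map_sum]
    rw [Finset.sum_comm]
    refine Finset.sum_congr rfl fun v _ => Finset.sum_congr rfl fun w _ => ?_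
    simp only [map_mul, map_prod, inner_conj_symm, RCLike.star_def, RCLike.conj_conj]
    ring
  re_inner_nonneg x := by
    obtain ⟨c, rfl⟩ := AlgTensor.exists_finsupp x
    rw [AlgTensor.form_sum]
    have h := (posSemidef_prod Finset.univ
      (fun j => Matrix.gram ℂ fun v : (∀ j, H j) => v j)
      (fun j => Matrix.gram ℂ fun v : (∀ j, H j) => v j)
      (fun j => posSemidef_gram _)
      (fun j => by rw [sub_self]; exact Matrix.PosSemidef.zero)).1.2 c
    exact (RCLike.nonneg_iff.1 h).1
  add_left x y z := by simp
  smul_left x y r := by simp [LinearMap.map_smulₛₗ]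

instance : SeminormedAddCommGroup (AlgTensor H) :=
  @InnerProductSpace.Core.toSeminormedAddCommGroup ℂ (AlgTensor H) _ _ _ (AlgTensor.core H)

instance : InnerProductSpace ℂ (AlgTensor H) := InnerProductSpace.ofCore (AlgTensor.core H)

theorem AlgTensor.inner_eq_form (x y : AlgTensor H) : inner ℂ x y = AlgTensor.form y x := rfl

theorem AlgTensor.inner_tprod (v w : ∀ j, H j) :
    inner ℂ (AlgTensor.tprod v) (AlgTensor.tprod w) = ∏ j, inner ℂ (v j) (w j) :=
  AlgTensor.form_tprod_tprod v w

variable (H) in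
/-- The Hilbert space tensor product of the Hilbert spaces `H j`: the completion of the algebraic
tensor product. This is the state space of the composite system. -/
abbrev HilbertTensor : Type u := UniformSpace.Completion (AlgTensor H)

/-- The algebraic tensor product of operators. -/
def AlgTensor.mapₗ (A : ∀ j, H j →L[ℂ] H j) : AlgTensor H →ₗ[ℂ] AlgTensor H :=
  (PiTensorProduct.map (fun j => (A j : H j →ₗ[ℂ] H j)) :
    PiTensorProduct ℂ H →ₗ[ℂ] PiTensorProduct ℂ H)

theorem AlgTensor.mapₗ_tprod (A : ∀ j, H j →L[ℂ] H j) (v : ∀ j, H j) :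
    AlgTensor.mapₗ A (AlgTensor.tprod v) = AlgTensor.tprod fun j => A j (v j) :=
  PiTensorProduct.map_tprod _ _

theorem AlgTensor.norm_mapₗ_le (A : ∀ j, H j →L[ℂ] H j) (x : AlgTensor H) :
    ‖AlgTensor.mapₗ A x‖ ≤ (∏ j, ‖A j‖) * ‖x‖ := by
  refine le_of_sq_le_sq ?_ (by positivity)
  rw [mul_pow, ← Finset.prod_pow, norm_sq_eq_re_inner (𝕜 := ℂ), norm_sq_eq_re_inner (𝕜 := ℂ)]
  obtain ⟨c, rfl⟩ := AlgTensor.exists_finsupp x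
  have h := (posSemidef_prod Finset.univ
      (fun j => Matrix.gram ℂ (A j ∘ fun v : (∀ j, H j) => v j))
      (fun j => ‖A j‖ ^ 2 • Matrix.gram ℂ fun v : (∀ j, H j) => v j)
      (fun j => posSemidef_gram _)
      (fun j => Matrix.posSemidef_opNorm_smul_gram_sub_gram _ _)).2.2 c
  have h' := (RCLike.nonneg_iff.1 h).1
  have e1 : inner ℂ (AlgTensor.mapₗ A (c.sum fun v a => a • AlgTensor.tprod v))
      (AlgTensor.mapₗ A (c.sum fun v a => a • AlgTensor.tprod v)) =
      c.sum fun v a => c.sum fun w b =>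
        star a * (∏ j, inner ℂ (A j (v j)) (A j (w j))) * b := by
    rw [AlgTensor.inner_eq_form]
    simp only [Finsupp.sum, map_sum, LinearMap.sum_apply, map_smul, LinearMap.smul_apply,
      LinearMap.map_smulₛₗ, AlgTensor.mapₗ_tprod, AlgTensor.form_tprod_tprod, smul_eq_mul,
      Finset.mul_sum]
    refine Finset.sum_congr rfl fun v _ => Finset.sum_congr rfl fun w _ => ?_
    simp only [RCLike.star_def]
    ring
  rw [e1, AlgTensor.inner_eq_form, AlgTensor.form_sum]
  have e2 : (c.sum fun i xi => c.sum fun j xj => star xi *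
      (Matrix.of (fun v w => ∏ j, (‖A j‖ ^ 2 • Matrix.gram ℂ fun v : (∀ j, H j) => v j) v w) -
        Matrix.of fun v w => ∏ j, Matrix.gram ℂ (A j ∘ fun v : (∀ j, H j) => v j) v w) i j * xj) =
      ((∏ j, ‖A j‖ ^ 2 : ℝ) : ℂ) *
        (c.sum fun v a => c.sum fun w b => star a * (∏ j, inner ℂ (v j) (w j)) * b) -
      c.sum fun v a => c.sum fun w b =>
        star a * (∏ j, inner ℂ (A j (v j)) (A j (w j))) * b := by
    simp only [Finsupp.sum, Finset.mul_sum, ← Finset.sum_sub_distrib]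
    refine Finset.sum_congr rfl fun v _ => Finset.sum_congr rfl fun w _ => ?_
    simp only [Matrix.sub_apply, Matrix.of_apply, Matrix.smul_apply, Matrix.gram_apply,
      Function.comp_apply, Complex.real_smul, Finset.prod_mul_distrib, Complex.ofReal_prod]
    ring
  rw [e2, map_sub, RCLike.re_to_complex, Complex.re_ofReal_mul] at h'
  exact sub_nonneg.1 h'

/-- The tensor product `A 0 ⊗ A 1 ⊗ ⋯ ⊗ A (n - 1)` of bounded operators, as a bounded operator on
the Hilbert space tensor product. -/
def tensorOp (A : ∀ j, H j →L[ℂ] H j) : HilbertTensor H →L[ℂ] HilbertTensor H :=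
  ((AlgTensor.mapₗ A).mkContinuous (∏ j, ‖A j‖) (AlgTensor.norm_mapₗ_le A)).completion

theorem tensorOp_coe_tprod (A : ∀ j, H j →L[ℂ] H j) (v : ∀ j, H j) :
    tensorOp A ((AlgTensor.tprod v : AlgTensor H) : HilbertTensor H) =
      ((AlgTensor.tprod fun j => A j (v j) : AlgTensor H) : HilbertTensor H) := by
  rw [tensorOp, ContinuousLinearMap.completion_apply_coe, LinearMap.mkContinuous_apply,
    AlgTensor.mapₗ_tprod]

end Tensor

/-! ### Measurements and states -/

/-- A measurement with outcomes in `{0, 1}` (a two-outcome POVM) on the Hilbert space `E`. -/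
structure BinaryMeasurement (E : Type u) [NormedAddCommGroup E] [InnerProductSpace ℂ E] where
  /-- The effect of each outcome. -/
  effect : ZMod 2 → E →L[ℂ] E
  isPositive : ∀ m, (effect m).IsPositive
  sum_effect : ∑ m, effect m = 1

/-- A von Neumann (projective) measurement. -/
def BinaryMeasurement.IsProjective {E : Type u} [NormedAddCommGroup E] [InnerProductSpace ℂ E]
    (M : BinaryMeasurement E) : Prop :=
  ∀ m, M.effect m * M.effect m = M.effect m

/-- A quantum state (density operator) `ρ = ∑ l, p l • |ψ l⟩⟨ψ l|` on the Hilbert space `K`, given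
as a statistical ensemble of countably many pure states. -/
structure QuantumState (K : Type u) [NormedAddCommGroup K] where
  /-- The probability of the `l`-th pure state. -/
  weight : ℕ → ℝ
  /-- The `l`-th pure state. -/
  vec : ℕ → K
  weight_nonneg : ∀ l, 0 ≤ weight l
  hasSum_weight : HasSum weight 1
  norm_vec : ∀ l, ‖vec l‖ = 1

/-- The ensemble consists of one pure state, with probability one. -/
def QuantumState.IsPure {K : Type u} [NormedAddCommGroup K] (ρ : QuantumState K) : Prop :=
  ∃ l, ρ.weight l = 1

/-- The expectation `Tr (ρ A) = ∑ l, p l * ⟪ψ l, A (ψ l)⟫` (its real part; `A` will be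
self-adjoint). -/
def QuantumState.expect {K : Type u} [NormedAddCommGroup K] [InnerProductSpace ℂ K]
    (ρ : QuantumState K) (A : K →L[ℂ] K) : ℝ :=
  ∑' l, ρ.weight l * (inner ℂ (ρ.vec l) (A (ρ.vec l))).re

/-! ### Non-adaptive measurement-based quantum computing -/

/-- A non-adaptive measurement-based computation with `k` input bits and `n` parties. Bits are
elements of `ZMod 2`, so that XOR is addition. -/
structure NMBQC (k n : ℕ) where
  /-- The Hilbert space of each party; its dimension is arbitrary. -/
  Space : Fin n → Type u
  [normedAddCommGroup : ∀ j, NormedAddCommGroup (Space j)]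
  [innerProductSpace : ∀ j, InnerProductSpace ℂ (Space j)]
  [completeSpace : ∀ j, CompleteSpace (Space j)]
  /-- The resource state shared by the parties. -/
  state : QuantumState (HilbertTensor Space)
  /-- The measurement that party `j` makes if it receives the bit `s`. -/
  meas : ∀ (j : Fin n) (_ : ZMod 2), BinaryMeasurement (Space j)
  /-- The XORs of input bits that the control computer makes to get the measurement settings. -/
  P : Matrix (Fin n) (Fin k) (ZMod 2)
  /-- Possible negations of the measurement settings. -/
  b : Fin n → ZMod 2

namespace NMBQC

attribute [instance] NMBQC.normedAddCommGroup NMBQC.innerProductSpace NMBQC.completeSpace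

variable {k n : ℕ} (R : NMBQC.{u} k n)

/-- The measurement settings `s = P x ⊕ b` that the control computer sends to the parties. They
depend on the input only, never on measurement outcomes. -/
def setting (x : Fin k → ZMod 2) : Fin n → ZMod 2 := R.P.mulVec x + R.b

/-- The probability `p(m|s) = Tr (ρ ⨂ⱼ E_{m j}^{s j})` of the outcomes `m` for the settings `s`. -/
def prob (m s : Fin n → ZMod 2) : ℝ :=
  R.state.expect (tensorOp fun j => (R.meas j (s j)).effect (m j))

/-- The probability that the output, the parity of the outcomes, is `f x` on the input `x`. -/
def successProb (f : (Fin k → ZMod 2) → ZMod 2) (x : Fin k → ZMod 2) : ℝ :=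
  ∑ m : Fin n → ZMod 2 with ∑ j, m j = f x, R.prob m (R.setting x)

/-- The mean success probability for a uniformly random input. -/
def meanSuccessProb (f : (Fin k → ZMod 2) → ZMod 2) : ℝ :=
  1 / 2 ^ k * ∑ x : Fin k → ZMod 2, R.successProb f x

/-- The computation performs the Boolean function `f` deterministically. -/
def Performs (f : (Fin k → ZMod 2) → ZMod 2) : Prop := R.meanSuccessProb f = 1

/-- The computation has a pure resource state and von Neumann measurements, and every party's
setting is a non-trivial XOR of input bits. -/
structure IsStandard : Prop where
  pure : R.state.IsPure
  projective : ∀ j s, (R.meas j s).IsProjective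
  offset : R.b = 0
  row_ne_zero : ∀ j, R.P j ≠ 0

end NMBQC

/-- The `k`-bit NAND function `x ↦ 1 ⊕ ∏ j, x j`. -/
def nand (k : ℕ) (x : Fin k → ZMod 2) : ZMod 2 := (∏ j, x j) + 1

end MBQC

end

/-! Each two-outcome measurement is replaced by the observable `E₀ - E₁`, a symmetric contraction.
The success probability on `x` is `(1 + sign (f x) * ⟨⨂ B j (s j)⟩) / 2`, so a computation is
deterministic exactly when each of these correlations is `±1` with the right sign (`performs_iff`).
Equality in Cauchy-Schwarz then makes every vector `ψ` of positive weight a common eigenvector of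
all the tensor products, with eigenvalues `sign (f x)`.

Lower bound: put `A j = B j 1 * B j 0`. Although `(B j 0)²` need not be the identity, it acts as one
on `ψ`, so for every set `F` of inputs `⨂ A j ^ ∑ x ∈ F, (P x)_j` multiplies `ψ` by `∏ x ∈ F, sign
(f x + f 0)` (`tensorOp_pow_apply`). Suppose that `c ≠ 0` is not a row of `P`. Every row takes the
value one equally often on `c ⬝ᵥ x = 0` and on its complement, so both sets give the same operator
and hence the same eigenvalue. But these two equal signs have product `-1`, since AND has odd
weight. So all `2 ^ k - 1` nonzero vectors are rows (`exists_row_eq`).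

Construction: one party for each `a ≠ 0`, a GHZ state, and equatorial measurements whose angles are
the Fourier coefficients of AND. The total angle is `π` at the all-ones input and `0` elsewhere
(`sum_angle`), which the GHZ state turns into a sign. -/

noncomputable section

open scoped ComplexConjugate ComplexOrder

namespace MBQC

/-! ### Tensor products of bounded operators -/

section TensorOp

variable {n : ℕ} {H : Fin n → Type u} [∀ j, NormedAddCommGroup (H j)]
  [∀ j, InnerProductSpace ℂ (H j)]

/-- The elementary tensor, as an element of the Hilbert space tensor product. -/
def elem (v : ∀ j, H j) : HilbertTensor H := ((AlgTensor.tprod v : AlgTensor H) : HilbertTensor H)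

theorem tensorOp_elem (A : ∀ j, H j →L[ℂ] H j) (v : ∀ j, H j) :
    tensorOp A (elem v) = elem fun j => A j (v j) :=
  tensorOp_coe_tprod A v

theorem inner_elem (v w : ∀ j, H j) :
    inner ℂ (elem v) (elem w) = ∏ j, inner ℂ (v j) (w j) := by
  rw [elem, elem, UniformSpace.Completion.inner_coe, AlgTensor.inner_tprod]

/-- Elementary tensors span a dense subspace, so closed linear conditions need to be checked only on
them. -/
theorem elem_induction {p : HilbertTensor H → Prop} (hc : IsClosed {x | p x})
    (h0 : p 0) (hadd : ∀ x y, p x → p y → p (x + y)) (hsmul : ∀ (a : ℂ) x, p x → p (a • x))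
    (h : ∀ v, p (elem v)) (x : HilbertTensor H) : p x := by
  induction x using UniformSpace.Completion.induction_on with
  | hp => exact hc
  | ih x =>
    have hx : x ∈ Submodule.span ℂ (Set.range (AlgTensor.tprod : (∀ j, H j) → AlgTensor H)) := by
      rw [AlgTensor.span_tprod]; trivial
    induction hx using Submodule.span_induction with
    | mem x hx => obtain ⟨v, rfl⟩ := hx; exact h v
    | zero => rwa [UniformSpace.Completion.coe_zero]
    | add x y _ _ hx hy => rw [UniformSpace.Completion.coe_add]; exact hadd _ _ hx hy
    | smul a x _ hx => rw [UniformSpace.Completion.coe_smul]; exact hsmul a _ hx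

theorem ext_elem {A B : HilbertTensor H →L[ℂ] HilbertTensor H}
    (h : ∀ v, A (elem v) = B (elem v)) : A = B := by
  ext x
  induction x using elem_induction with
  | hc => exact isClosed_eq A.continuous B.continuous
  | h0 => simp
  | hadd x y hx hy => simp [hx, hy]
  | hsmul a x hx => simp [hx]
  | h v => exact h v

theorem tensorOp_mul (A B : ∀ j, H j →L[ℂ] H j) :
    tensorOp A * tensorOp B = tensorOp fun j => A j * B j :=
  ext_elem fun v => by simp [tensorOp_elem]

theorem tensorOp_one : tensorOp (fun j => (1 : H j →L[ℂ] H j)) = 1 :=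
  ext_elem fun v => by simp [tensorOp_elem]

/-- Multilinear expansion. With `c = 1` it shows that the outcome probabilities sum to one; with `c
= sign` it turns the parity of the outcomes into a product of observables. -/
theorem tensorOp_sum (E : ∀ j, ZMod 2 → H j →L[ℂ] H j) (c : ZMod 2 → ℂ) :
    tensorOp (fun j => ∑ z, c z • E j z) =
      ∑ m : Fin n → ZMod 2, (∏ j, c (m j)) • tensorOp fun j => E j (m j) := by
  refine ext_elem fun v => ?_
  rw [sum_apply]
  simp only [smul_apply, tensorOp_elem, sum_apply]
  have h := MultilinearMap.map_sum (PiTensorProduct.tprod ℂ (s := H))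
    (fun j (z : ZMod 2) => c z • E j z (v j))
  have h' : (AlgTensor.tprod fun j => ∑ z, c z • E j z (v j) : AlgTensor H) =
      ∑ m : Fin n → ZMod 2, (∏ j, c (m j)) • AlgTensor.tprod fun j => E j (m j) (v j) := by
    refine h.trans (Finset.sum_congr rfl fun m _ => ?_)
    exact MultilinearMap.map_smul_univ (PiTensorProduct.tprod ℂ (s := H)) _ _
  rw [elem, h']
  simp only [elem]
  rw [← UniformSpace.Completion.coe_toComplL (𝕜 := ℂ), map_sum]
  simp

theorem norm_tensorOp_le (A : ∀ j, H j →L[ℂ] H j) : ‖tensorOp A‖ ≤ ∏ j, ‖A j‖ := by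
  rw [tensorOp]
  refine ContinuousLinearMap.opNorm_le_bound _ (by positivity) fun x => ?_
  induction x using UniformSpace.Completion.induction_on with
  | hp => exact isClosed_le (by fun_prop) (by fun_prop)
  | ih x =>
    rw [ContinuousLinearMap.completion_apply_coe, UniformSpace.Completion.norm_coe,
      UniformSpace.Completion.norm_coe]
    exact AlgTensor.norm_mapₗ_le A x

theorem norm_tensorOp_apply_le {A : ∀ j, H j →L[ℂ] H j} (hA : ∀ j, ‖A j‖ ≤ 1)
    (x : HilbertTensor H) : ‖tensorOp A x‖ ≤ ‖x‖ :=
  (tensorOp A).le_of_opNorm_le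
    ((norm_tensorOp_le A).trans (Finset.prod_le_one (fun _ _ => norm_nonneg _) fun j _ => hA j)) x
    |>.trans_eq (one_mul _)

theorem inner_tensorOp_left {A B : ∀ j, H j →L[ℂ] H j}
    (h : ∀ j v w, inner ℂ (A j v) w = inner ℂ v (B j w)) (x y : HilbertTensor H) :
    inner ℂ (tensorOp A x) y = inner ℂ x (tensorOp B y) := by
  induction x using elem_induction with
  | hc => exact isClosed_eq (by fun_prop) (by fun_prop)
  | h0 => simp
  | hadd x x' hx hx' => simp [hx, hx', inner_add_left]
  | hsmul a x hx => simp [hx, inner_smul_left]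
  | h v =>
    induction y using elem_induction with
    | hc => exact isClosed_eq (by fun_prop) (by fun_prop)
    | h0 => simp
    | hadd x x' hx hx' => simp [hx, hx', inner_add_right]
    | hsmul a x hx => simp [hx, inner_smul_right]
    | h w => simp [tensorOp_elem, inner_elem, h]

end TensorOp

/-- A vector that a contraction `A` maps to a vector with which it has the largest possible
overlap is an eigenvector. -/
theorem eq_smul_of_inner_eq {K : Type*} [NormedAddCommGroup K] [InnerProductSpace ℂ K]
    {x y : K} (hx : ‖x‖ = 1) (hy : ‖y‖ ≤ 1) {σ : ℝ} (hσ : σ * σ = 1)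
    (h : σ * (inner ℂ x y).re = 1) : y = (σ : ℂ) • x := by
  have h1 : ‖y - (σ : ℂ) • x‖ ^ 2 ≤ 0 := by
    rw [@norm_sub_sq ℂ, norm_smul, inner_smul_right, hx, ← inner_conj_symm y x]
    simp only [RCLike.re_to_complex, Complex.re_ofReal_mul, Complex.conj_re, h]
    have : ‖(σ : ℂ)‖ ^ 2 = 1 := by
      rw [Complex.norm_real, Real.norm_eq_abs, sq_abs, sq, hσ]
    rw [mul_pow, this]
    nlinarith [norm_nonneg y]
  have h2 : ‖y - (σ : ℂ) • x‖ = 0 := by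
    nlinarith [norm_nonneg (y - (σ : ℂ) • x)]
  exact sub_eq_zero.1 (norm_eq_zero.1 h2)

/-! ### Signs of bits -/

/-- The sign `(-1) ^ z` of a bit. -/
def sign (z : ZMod 2) : ℝ := if z = 0 then 1 else -1

theorem zmod_two_cases (z : ZMod 2) : z = 0 ∨ z = 1 := by
  revert z; decide

@[simp] theorem sign_zero : sign 0 = 1 := by simp [sign]

@[simp] theorem sign_one : sign 1 = -1 := by simp [sign]

theorem sign_add (y z : ZMod 2) : sign (y + z) = sign y * sign z := by
  rcases zmod_two_cases y with rfl | rfl <;> rcases zmod_two_cases z with rfl | rfl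
  · simp
  · simp
  · simp
  · rw [show (1 + 1 : ZMod 2) = 0 by decide]; simp

theorem sign_sum {ι : Type*} (s : Finset ι) (z : ι → ZMod 2) :
    sign (∑ j ∈ s, z j) = ∏ j ∈ s, sign (z j) := by
  classical
  induction s using Finset.induction_on with
  | empty => simp
  | insert j s hj ih => rw [Finset.sum_insert hj, Finset.prod_insert hj, sign_add, ih]

theorem sign_mul_self (z : ZMod 2) : sign z * sign z = 1 := by
  rcases zmod_two_cases z with rfl | rfl <;> simp

theorem val_eq_sign (z : ZMod 2) : (z.val : ℝ) = (1 - sign z) / 2 := by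
  rcases zmod_two_cases z with rfl | rfl
  · simp
  · simp [ZMod.val_one]

/-- Orthogonality of the characters of `𝔽₂ᵏ`: the sum factors over the coordinates, and the factor
`1 + sign (y j)` vanishes where `y j = 1`. -/
theorem sum_sign_dotProduct {k : ℕ} (y : Fin k → ZMod 2) :
    ∑ a : Fin k → ZMod 2, sign (a ⬝ᵥ y) = if y = 0 then 2 ^ k else 0 := by
  have h : ∀ a : Fin k → ZMod 2, sign (a ⬝ᵥ y) = ∏ j, sign (a j * y j) := fun a => sign_sum _ _
  have h2 := Finset.prod_univ_sum (fun _ : Fin k => (Finset.univ : Finset (ZMod 2)))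
    (fun j z => sign (z * y j))
  rw [Fintype.piFinset_univ] at h2
  simp only [h, ← h2]
  have h3 : ∀ j, ∑ z : ZMod 2, sign (z * y j) = 1 + sign (y j) := fun j => by
    rw [show (Finset.univ : Finset (ZMod 2)) = {0, 1} by decide, Finset.sum_pair (by decide)]
    simp
  simp only [h3]
  split_ifs with hy
  · subst hy; norm_num
  · obtain ⟨j, hj⟩ := Function.ne_iff.1 hy
    refine Finset.prod_eq_zero (Finset.mem_univ j) ?_
    rw [(zmod_two_cases (y j)).resolve_left hj]
    simp

/-! ### Observables -/

section Observable

variable {E : Type u} [NormedAddCommGroup E] [InnerProductSpace ℂ E]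

/-- The observable `E₀ - E₁` of a two-outcome measurement. -/
def BinaryMeasurement.obs (M : BinaryMeasurement E) : E →L[ℂ] E :=
  ∑ z, (sign z : ℂ) • M.effect z

theorem BinaryMeasurement.effect_zero_add_effect_one (M : BinaryMeasurement E) :
    M.effect 0 + M.effect 1 = 1 := by
  rw [← M.sum_effect, show (Finset.univ : Finset (ZMod 2)) = {0, 1} by decide,
    Finset.sum_pair (by decide)]

theorem BinaryMeasurement.obs_eq (M : BinaryMeasurement E) :
    M.obs = M.effect 0 - M.effect 1 := by
  rw [obs, show (Finset.univ : Finset (ZMod 2)) = {0, 1} by decide, Finset.sum_pair (by decide)]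
  simp [sub_eq_add_neg]

theorem BinaryMeasurement.inner_obs_left (M : BinaryMeasurement E) (v w : E) :
    inner ℂ (M.obs v) w = inner ℂ v (M.obs w) := by
  simp only [obs_eq, sub_apply, inner_sub_left, inner_sub_right]
  exact congrArg₂ _ ((M.isPositive 0).isSymmetric v w) ((M.isPositive 1).isSymmetric v w)

/-- For `p = E₀ x` and `q = E₁ x`, the bound `‖p - q‖ ≤ ‖p + q‖` amounts to `0 ≤ Re ⟪p, q⟫`, that
is, to positivity of the product of the commuting effects. -/
theorem BinaryMeasurement.norm_obs_le_one (M : BinaryMeasurement E) : ‖M.obs‖ ≤ 1 := by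
  refine ContinuousLinearMap.opNorm_le_bound _ zero_le_one fun x => ?_
  set p := M.effect 0 x
  set q := M.effect 1 x
  have hx : x = p + q := by
    have := congrArg (fun A : E →L[ℂ] E => A x) M.effect_zero_add_effect_one
    simpa using this.symm
  have hpq : 0 ≤ (inner ℂ p q).re := by
    -- `E₀ E₁ = E₀ E₁ E₀ + E₁ E₀ E₁`
    have h0 : 0 ≤ (inner ℂ (M.effect 0 q) q).re := ((M.isPositive 0).re_inner_nonneg_left q)
    have h1 : 0 ≤ (inner ℂ (M.effect 1 p) p).re := ((M.isPositive 1).re_inner_nonneg_left p)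
    have e0 : M.effect 0 p + M.effect 0 q = p := by rw [← map_add, ← hx]
    have e1 : M.effect 1 p + M.effect 1 q = q := by rw [← map_add, ← hx]
    have e2 : M.effect 0 p + M.effect 1 p = p := by
      have := congrArg (fun A : E →L[ℂ] E => A p) M.effect_zero_add_effect_one
      simpa using this
    have e3 : M.effect 1 p = M.effect 0 q := add_left_cancel (e2.trans e0.symm)
    have e4 : inner ℂ p q = inner ℂ (M.effect 0 q) q + inner ℂ (M.effect 1 p) p := by
      rw [e3, ← inner_add_right, add_comm, ← hx, ← e3]
      exact ((M.isPositive 1).isSymmetric p x).symm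
    rw [e4, Complex.add_re]
    exact add_nonneg h0 h1
  rw [one_mul, obs_eq, sub_apply]
  change ‖p - q‖ ≤ ‖x‖
  rw [hx]
  refine le_of_sq_le_sq ?_ (norm_nonneg _)
  rw [@norm_sub_sq ℂ, @norm_add_sq ℂ]
  simp only [RCLike.re_to_complex]
  linarith

end Observable

/-! ### Expectations -/

section Expect

variable {K : Type u} [NormedAddCommGroup K] [InnerProductSpace ℂ K] (ρ : QuantumState K)

theorem QuantumState.abs_re_inner_le (A : K →L[ℂ] K) (l : ℕ) :
    |(inner ℂ (ρ.vec l) (A (ρ.vec l))).re| ≤ ‖A‖ := by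
  refine (Complex.abs_re_le_norm _).trans ((norm_inner_le_norm _ _).trans ?_)
  have := A.le_opNorm (ρ.vec l)
  rw [ρ.norm_vec] at this ⊢
  linarith

theorem QuantumState.summable (A : K →L[ℂ] K) :
    Summable fun l => ρ.weight l * (inner ℂ (ρ.vec l) (A (ρ.vec l))).re := by
  refine Summable.of_norm_bounded (ρ.hasSum_weight.summable.mul_right ‖A‖) fun l => ?_
  rw [Real.norm_eq_abs, abs_mul, abs_of_nonneg (ρ.weight_nonneg l)]
  exact mul_le_mul_of_nonneg_left (ρ.abs_re_inner_le A l) (ρ.weight_nonneg l)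

theorem QuantumState.expect_sum {ι : Type*} (s : Finset ι) (c : ι → ℝ) (A : ι → K →L[ℂ] K) :
    ρ.expect (∑ i ∈ s, (c i : ℂ) • A i) = ∑ i ∈ s, c i * ρ.expect (A i) := by
  have h : ∀ i ∈ s, HasSum (fun l => c i * (ρ.weight l * (inner ℂ (ρ.vec l) (A i (ρ.vec l))).re))
      (c i * ρ.expect (A i)) := fun i _ => (ρ.summable (A i)).hasSum.mul_left _
  rw [← (hasSum_sum h).tsum_eq, expect]
  refine tsum_congr fun l => ?_
  rw [sum_apply, inner_sum, Complex.re_sum, Finset.mul_sum]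
  refine Finset.sum_congr rfl fun i _ => ?_
  rw [smul_apply, inner_smul_right, Complex.re_ofReal_mul]
  ring

theorem QuantumState.expect_one : ρ.expect 1 = 1 := by
  rw [← ρ.hasSum_weight.tsum_eq, expect]
  refine tsum_congr fun l => ?_
  simp [ρ.norm_vec]

/-- If the expectation of a contraction is `±1`, then every vector of the ensemble is an
eigenvector. -/
theorem QuantumState.eigenvector_of_expect {A : K →L[ℂ] K} (hA : ∀ x, ‖A x‖ ≤ ‖x‖) {σ : ℝ}
    (hσ : σ * σ = 1) (h : σ * ρ.expect A = 1) (l : ℕ) (hl : 0 < ρ.weight l) :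
    A (ρ.vec l) = (σ : ℂ) • ρ.vec l := by
  have hA1 : ∀ i, ‖A (ρ.vec i)‖ ≤ 1 := fun i => (hA _).trans_eq (ρ.norm_vec i)
  refine eq_smul_of_inner_eq (ρ.norm_vec l) (hA1 l) hσ ?_
  set g : ℕ → ℝ := fun i => σ * (inner ℂ (ρ.vec i) (A (ρ.vec i))).re
  have hg : ∀ i, g i ≤ 1 := fun i => by
    have h1 : |(inner ℂ (ρ.vec i) (A (ρ.vec i))).re| ≤ 1 := by
      refine (Complex.abs_re_le_norm _).trans ((norm_inner_le_norm _ _).trans ?_)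
      rw [ρ.norm_vec, one_mul]
      exact hA1 i
    refine (le_abs_self _).trans ?_
    rw [abs_mul, show |σ| = 1 by nlinarith [abs_mul_abs_self σ, abs_nonneg σ], one_mul]
    exact h1
  have h1 : HasSum (fun i => ρ.weight i * g i) 1 := by
    have := (ρ.summable A).hasSum.mul_left σ
    change HasSum _ (σ * ρ.expect A) at this
    rw [h] at this
    refine this.congr_fun ?_
    intro i
    simp only [g]
    ring
  -- The weights also sum to one, so the average of `1 - g` is zero; its terms are nonnegative and
  -- therefore all vanish.
  have h2 : HasSum (fun i => ρ.weight i * (1 - g i)) 0 := by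
    have := ρ.hasSum_weight.sub h1
    rw [sub_self] at this
    refine this.congr_fun ?_
    intro i
    ring
  have h3 := (hasSum_zero_iff_of_nonneg fun i =>
    mul_nonneg (ρ.weight_nonneg i) (sub_nonneg.2 (hg i))).1 h2
  have h4 := congrFun h3 l
  simp only [Pi.zero_apply, mul_eq_zero, hl.ne', false_or] at h4
  change g l = 1
  linarith

end Expect

theorem QuantumState.exists_weight_pos {K : Type u} [NormedAddCommGroup K] (ρ : QuantumState K) :
    ∃ l, 0 < ρ.weight l := by
  by_contra! h
  have h0 : ρ.weight = 0 := funext fun l => le_antisymm (h l) (ρ.weight_nonneg l)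
  have := ρ.hasSum_weight
  rw [h0] at this
  exact one_ne_zero (this.unique hasSum_zero)

/-! ### Success probability as a correlation of observables -/

namespace NMBQC

variable {k n : ℕ} (R : NMBQC.{u} k n)

/-- The tensor product of the observables that are measured for the settings `s`. -/
def obs (s : Fin n → ZMod 2) : HilbertTensor R.Space →L[ℂ] HilbertTensor R.Space :=
  tensorOp fun j => (R.meas j (s j)).obs

theorem sum_prod_mul_prob (c : ZMod 2 → ℝ) (s : Fin n → ZMod 2) :
    ∑ m : Fin n → ZMod 2, (∏ j, c (m j)) * R.prob m s =
      R.state.expect (tensorOp fun j => ∑ z, (c z : ℂ) • (R.meas j (s j)).effect z) := by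
  rw [tensorOp_sum]
  simp only [← Complex.ofReal_prod]
  rw [QuantumState.expect_sum]
  rfl

/-- The indicator of `y = z` for bits is `(1 + sign y * sign z) / 2`. -/
theorem successProb_eq (f : (Fin k → ZMod 2) → ZMod 2) (x : Fin k → ZMod 2) :
    R.successProb f x = (1 + sign (f x) * R.state.expect (R.obs (R.setting x))) / 2 := by
  have h1 : ∑ m : Fin n → ZMod 2, R.prob m (R.setting x) = 1 := by
    have := R.sum_prod_mul_prob (fun _ => 1) (R.setting x)
    simpa [(R.meas _ _).sum_effect, tensorOp_one, QuantumState.expect_one] using this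
  have h2 : ∑ m : Fin n → ZMod 2, sign (∑ j, m j) * R.prob m (R.setting x) =
      R.state.expect (R.obs (R.setting x)) := by
    simp only [sign_sum]
    exact R.sum_prod_mul_prob sign (R.setting x)
  rw [← h2]
  conv_rhs => enter [1, 1]; rw [← h1]
  rw [successProb, Finset.sum_filter, Finset.mul_sum, ← Finset.sum_add_distrib, Finset.sum_div]
  refine Finset.sum_congr rfl fun m _ => ?_
  generalize ∑ j, m j = y
  generalize f x = z
  rcases zmod_two_cases y with rfl | rfl <;> rcases zmod_two_cases z with rfl | rfl <;> simp

theorem norm_obs_apply_le (s : Fin n → ZMod 2) (x : HilbertTensor R.Space) :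
    ‖R.obs s x‖ ≤ ‖x‖ :=
  norm_tensorOp_apply_le (fun _ => BinaryMeasurement.norm_obs_le_one _) x

/-- No correlation exceeds one, because the observables are contractions; a mean of one therefore
forces equality on every input. -/
theorem performs_iff (f : (Fin k → ZMod 2) → ZMod 2) :
    R.Performs f ↔ ∀ x, sign (f x) * R.state.expect (R.obs (R.setting x)) = 1 := by
  have hcard : (Finset.univ : Finset (Fin k → ZMod 2)).card = 2 ^ k := by
    simp [Finset.card_univ]
  have hle : ∀ x, sign (f x) * R.state.expect (R.obs (R.setting x)) ≤ 1 := fun x => by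
    have hn : ‖R.obs (R.setting x)‖ ≤ 1 :=
      ContinuousLinearMap.opNorm_le_bound _ zero_le_one fun y => by
        rw [one_mul]; exact R.norm_obs_apply_le _ y
    have hs := R.state.summable (R.obs (R.setting x))
    have := (hs.hasSum.mul_left (sign (f x)))
    refine hasSum_le (fun l => ?_) this R.state.hasSum_weight
    have h1 := (R.state.abs_re_inner_le (R.obs (R.setting x)) l).trans hn
    rw [mul_left_comm]
    refine mul_le_of_le_one_right (R.state.weight_nonneg l) ?_
    rcases zmod_two_cases (f x) with h | h <;> rw [h]
    · simpa using (abs_le.1 h1).2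
    · have := (abs_le.1 h1).1
      rw [sign_one]; linarith
  have key : R.Performs f ↔
      ∑ x, (1 - sign (f x) * R.state.expect (R.obs (R.setting x))) = 0 := by
    rw [Performs, meanSuccessProb]
    simp only [successProb_eq]
    rw [← Finset.sum_div, Finset.sum_add_distrib, Finset.sum_sub_distrib, Finset.sum_const, hcard]
    have : (2 : ℝ) ^ k ≠ 0 := by positivity
    simp only [nsmul_eq_mul, Nat.cast_pow, Nat.cast_ofNat, mul_one]
    field_simp
    constructor <;> intro h <;> linarith
  rw [key, Finset.sum_eq_zero_iff_of_nonneg fun x _ => sub_nonneg.2 (hle x)]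
  simp only [Finset.mem_univ, true_implies, sub_eq_zero]
  exact forall_congr' fun _ => eq_comm

end NMBQC

/-! ### The lower bound -/

section LowerBound

variable {n : ℕ} {H : Fin n → Type u} [∀ j, NormedAddCommGroup (H j)]
  [∀ j, InnerProductSpace ℂ (H j)]

/-- If a tensor product of symmetric contractions preserves the norm of a vector, then the squares
of some of the factors fix the vector. -/
theorem tensorOp_sq_apply_eq {A : ∀ j, H j →L[ℂ] H j} (hA : ∀ j, ‖A j‖ ≤ 1)
    (hs : ∀ j v w, inner ℂ (A j v) w = inner ℂ v (A j w)) {ψ : HilbertTensor H} (hψ : ‖ψ‖ = 1)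
    (h : ‖tensorOp A ψ‖ = 1) (p : Fin n → Prop) [DecidablePred p] :
    tensorOp (fun j => if p j then A j * A j else 1) ψ = ψ := by
  set C := tensorOp (fun j => if p j then A j else 1)
  have h1 : ∀ j, ‖(1 : H j →L[ℂ] H j)‖ ≤ 1 := fun j => ContinuousLinearMap.norm_id_le
  have hCle : ∀ x, ‖C x‖ ≤ ‖x‖ := norm_tensorOp_apply_le fun j => by
    split_ifs
    exacts [hA j, h1 j]
  have hDC : tensorOp (fun j => if p j then 1 else A j) * C = tensorOp A := by
    rw [tensorOp_mul]
    congr 1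
    ext1 j
    split_ifs <;> simp
  have hCC : C * C = tensorOp (fun j => if p j then A j * A j else 1) := by
    rw [tensorOp_mul]
    congr 1
    ext1 j
    split_ifs <;> simp
  -- `tensorOp A` is `C` followed by another contraction, so `C` cannot shrink `ψ` either.
  have hC1 : ‖C ψ‖ = 1 := by
    refine le_antisymm ((hCle ψ).trans_eq hψ) ?_
    rw [← h, ← hDC]
    refine norm_tensorOp_apply_le (fun j => ?_) (C ψ)
    split_ifs
    exacts [h1 j, hA j]
  rw [← hCC]
  -- By symmetry `⟪ψ, C (C ψ)⟫ = ‖C ψ‖² = 1`, the largest overlap possible for a contraction.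
  have := eq_smul_of_inner_eq (y := C (C ψ)) hψ (((hCle _).trans (hCle _)).trans_eq hψ)
    (mul_one 1) ?_
  · simpa using this
  · rw [one_mul, ← inner_tensorOp_left (A := fun j => if p j then A j else 1)]
    · change (inner ℂ (C ψ) (C ψ)).re = 1
      rw [inner_self_eq_norm_sq_to_K, hC1]
      simp
    · intro j v w
      split_ifs
      exacts [hs j v w, rfl]

/-- Comparing each input with the input `0` leaves powers of one operator per party. These commute,
so only the total exponent matters. It is a natural number, not a bit, because `B j 1 * B j 0` need
not have finite order. -/
theorem tensorOp_pow_apply {k : ℕ} {B : ∀ j, ZMod 2 → H j →L[ℂ] H j} (hB : ∀ j s, ‖B j s‖ ≤ 1)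
    (hs : ∀ j s v w, inner ℂ (B j s v) w = inner ℂ v (B j s w)) {ψ : HilbertTensor H}
    (hψ : ‖ψ‖ = 1) (P : Matrix (Fin n) (Fin k) (ZMod 2)) {f : (Fin k → ZMod 2) → ZMod 2}
    (h : ∀ x, tensorOp (fun j => B j (P.mulVec x j)) ψ = (sign (f x) : ℂ) • ψ)
    (F : Finset (Fin k → ZMod 2)) :
    tensorOp (fun j => (B j 1 * B j 0) ^ ∑ x ∈ F, (P.mulVec x j).val) ψ =
      ((∏ x ∈ F, sign (f x + f 0) : ℝ) : ℂ) • ψ := by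
  have h0 : tensorOp (fun j => B j 0) ψ = (sign (f 0) : ℂ) • ψ := by
    have := h 0
    simpa only [Matrix.mulVec_zero, Pi.zero_apply] using this
  have hn0 : ‖tensorOp (fun j => B j 0) ψ‖ = 1 := by
    rw [h0, norm_smul, hψ, Complex.norm_real, mul_one]
    rcases zmod_two_cases (f 0) with h | h <;> simp [h]
  have hx : ∀ x, tensorOp (fun j => (B j 1 * B j 0) ^ (P.mulVec x j).val) ψ =
      (sign (f x + f 0) : ℂ) • ψ := fun x => by
    -- Parties with setting `0` contribute `B j 0 * B j 0` on the right-hand side; the extra factor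
    -- on the left compensates for this and fixes `ψ`.
    have e : tensorOp (fun j => (B j 1 * B j 0) ^ (P.mulVec x j).val) *
        tensorOp (fun j => if P.mulVec x j = 0 then B j 0 * B j 0 else 1) =
        tensorOp (fun j => B j (P.mulVec x j)) * tensorOp (fun j => B j 0) := by
      rw [tensorOp_mul, tensorOp_mul]
      congr 1
      ext1 j
      rcases zmod_two_cases (P.mulVec x j) with h | h <;> rw [h]
      · simp
      · simp [ZMod.val_one]
    have e' := congrArg (fun T : HilbertTensor H →L[ℂ] HilbertTensor H => T ψ) e
    simp only [mul_apply_eq_comp, h0, map_smul, h] at e'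
    rw [tensorOp_sq_apply_eq (fun j => hB j 0) (fun j => hs j 0) hψ hn0] at e'
    rw [e', smul_smul, sign_add, mul_comm, Complex.ofReal_mul]
  classical
  induction F using Finset.induction_on with
  | empty => simp [tensorOp_one]
  | insert x F hxF ih =>
    have e : tensorOp (fun j => (B j 1 * B j 0) ^ ∑ x ∈ insert x F, (P.mulVec x j).val) =
        tensorOp (fun j => (B j 1 * B j 0) ^ (P.mulVec x j).val) *
          tensorOp (fun j => (B j 1 * B j 0) ^ ∑ x ∈ F, (P.mulVec x j).val) := by
      rw [tensorOp_mul]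
      congr 1
      ext1 j
      rw [Finset.sum_insert hxF, pow_add]
    rw [e, mul_apply_eq_comp, ih, map_smul, hx, Finset.prod_insert hxF, smul_smul,
      mul_comm, Complex.ofReal_mul]

/-- Two distinct nonzero linear functionals on `𝔽₂ᵏ` are balanced with respect to each other. -/
theorem sum_val_dotProduct_eq {k : ℕ} {a c : Fin k → ZMod 2} (hc : c ≠ 0) (hac : a ≠ c) :
    ∑ x : Fin k → ZMod 2 with c ⬝ᵥ x = 0, (a ⬝ᵥ x).val =
      ∑ x : Fin k → ZMod 2 with c ⬝ᵥ x ≠ 0, (a ⬝ᵥ x).val := by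
  -- Expanding `val` in characters leaves those of `c` and `c + a`, both nontrivial, so each sums to
  -- zero.
  have h1 : ∑ x : Fin k → ZMod 2, sign (c ⬝ᵥ x) * ((a ⬝ᵥ x).val : ℝ) = 0 := by
    have e : ∀ x : Fin k → ZMod 2, sign (c ⬝ᵥ x) * ((a ⬝ᵥ x).val : ℝ) =
        (sign (x ⬝ᵥ c) - sign (x ⬝ᵥ (c + a))) / 2 := fun x => by
      rw [val_eq_sign, dotProduct_add, sign_add, dotProduct_comm c, dotProduct_comm a]
      ring
    have hca : c + a ≠ 0 := fun h => hac (by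
      ext j
      have := congrFun h j
      rw [Pi.add_apply, Pi.zero_apply] at this
      rcases zmod_two_cases (c j) with h1 | h1 <;> rcases zmod_two_cases (a j) with h2 | h2 <;>
        simp_all)
    simp only [e]
    rw [← Finset.sum_div, Finset.sum_sub_distrib, sum_sign_dotProduct, sum_sign_dotProduct,
      if_neg hc, if_neg hca]
    simp
  have h2 : ∑ x : Fin k → ZMod 2, sign (c ⬝ᵥ x) * ((a ⬝ᵥ x).val : ℝ) =
      ∑ x : Fin k → ZMod 2 with c ⬝ᵥ x = 0, ((a ⬝ᵥ x).val : ℝ) -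
        ∑ x : Fin k → ZMod 2 with c ⬝ᵥ x ≠ 0, ((a ⬝ᵥ x).val : ℝ) := by
    rw [Finset.sum_filter, Finset.sum_filter, ← Finset.sum_sub_distrib]
    refine Finset.sum_congr rfl fun x _ => ?_
    rcases zmod_two_cases (c ⬝ᵥ x) with h | h <;> simp [h]
  rw [h1] at h2
  exact_mod_cast (sub_eq_zero.1 h2.symm)

/-- AND has odd weight: the sum of its values factors as `∏ j, ∑ z, z`, each factor being `0 + 1`.
-/
theorem sum_nand_add_nand_zero {k : ℕ} (hk : 0 < k) :
    ∑ x : Fin k → ZMod 2, (nand k x + nand k 0) = 1 := by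
  have e : ∀ x : Fin k → ZMod 2, nand k x + nand k 0 = ∏ j, x j := fun x => by
    rw [nand, nand, Finset.prod_eq_zero (f := (0 : Fin k → ZMod 2)) (Finset.mem_univ ⟨0, hk⟩) rfl, zero_add,
      add_assoc, show (1 + 1 : ZMod 2) = 0 by decide, add_zero]
  have h2 := Finset.prod_univ_sum (fun _ : Fin k => (Finset.univ : Finset (ZMod 2)))
    (fun _ z => z)
  rw [Fintype.piFinset_univ] at h2
  simp only [e, ← h2]
  rw [show ∑ z : ZMod 2, z = 1 by decide, Finset.prod_const_one]

/-- If every tensor product of observables for the settings `P x` has a common eigenvector with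
the NAND function as eigenvalues, then all nonzero vectors are rows of `P`. -/
theorem exists_row_eq {k : ℕ} {B : ∀ j, ZMod 2 → H j →L[ℂ] H j} (hB : ∀ j s, ‖B j s‖ ≤ 1)
    (hs : ∀ j s v w, inner ℂ (B j s v) w = inner ℂ v (B j s w)) {ψ : HilbertTensor H}
    (hψ : ‖ψ‖ = 1) (P : Matrix (Fin n) (Fin k) (ZMod 2))
    (h : ∀ x, tensorOp (fun j => B j (P.mulVec x j)) ψ = (sign (nand k x) : ℂ) • ψ)
    {c : Fin k → ZMod 2} (hc : c ≠ 0) : ∃ j, P j = c := by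
  by_contra! hP
  have hk : 0 < k := (Function.ne_iff.1 hc).choose.pos
  set a : ℝ := ∏ x : Fin k → ZMod 2 with c ⬝ᵥ x = 0, sign (nand k x + nand k 0)
  set b : ℝ := ∏ x : Fin k → ZMod 2 with c ⬝ᵥ x ≠ 0, sign (nand k x + nand k 0)
  have hab : a = b := by
    have h1 := tensorOp_pow_apply hB hs hψ P h (Finset.univ.filter fun x => c ⬝ᵥ x = 0)
    have h2 := tensorOp_pow_apply hB hs hψ P h (Finset.univ.filter fun x => c ⬝ᵥ x ≠ 0)
    have e : ∀ j, ∑ x : Fin k → ZMod 2 with c ⬝ᵥ x = 0, (P.mulVec x j).val =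
        ∑ x : Fin k → ZMod 2 with c ⬝ᵥ x ≠ 0, (P.mulVec x j).val := fun j =>
      sum_val_dotProduct_eq hc (hP j)
    simp only [e] at h1
    rw [h1] at h2
    have hψ0 : ψ ≠ 0 := by
      rintro rfl
      simp at hψ
    exact_mod_cast smul_left_injective ℂ hψ0 h2
  -- The two half-spaces partition the cube, so `a * b` is the sign of the total parity.
  have h1 : a * b = -1 := by
    rw [Finset.prod_filter_mul_prod_filter_not, ← sign_sum, sum_nand_add_nand_zero hk, sign_one]
  rw [hab] at h1
  nlinarith [mul_self_nonneg b]

end LowerBound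

namespace NMBQC

theorem card_le_of_performs_nand {k n : ℕ} (R : NMBQC.{u} k n) (h : R.Performs (nand k)) :
    2 ^ k - 1 ≤ n := by
  rw [performs_iff] at h
  obtain ⟨l, hl⟩ := R.state.exists_weight_pos
  have hrow : ∀ c : Fin k → ZMod 2, c ≠ 0 → ∃ j, R.P j = c := fun c hc =>
    exists_row_eq (B := fun j s => (R.meas j (s + R.b j)).obs)
      (fun j s => (R.meas j _).norm_obs_le_one) (fun j s => (R.meas j _).inner_obs_left)
      (R.state.norm_vec l) R.P
      (fun x => R.state.eigenvector_of_expect (R.norm_obs_apply_le _) (sign_mul_self _) (h x) l hl)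
      hc
  -- The rows together with the zero vector exhaust `𝔽₂ᵏ`, whence `2 ^ k ≤ n + 1`.
  have hsurj : Function.Surjective
      (fun o : Option (Fin n) => (o.elim 0 R.P : Fin k → ZMod 2)) := fun c => by
    by_cases hc : c = 0
    · exact ⟨none, hc.symm⟩
    · obtain ⟨j, hj⟩ := hrow c hc
      exact ⟨some j, hj⟩
  have := Fintype.card_le_of_surjective _ hsurj
  simp only [Fintype.card_pi, ZMod.card, Finset.prod_const, Finset.card_univ, Fintype.card_fin,
    Fintype.card_option] at this
  omega

end NMBQC

/-! ### The construction -/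

/-- The projective measurement of a symmetric involution. -/
def BinaryMeasurement.ofObs {E : Type u} [NormedAddCommGroup E] [InnerProductSpace ℂ E]
    (A : E →L[ℂ] E) (hs : ∀ v w, inner ℂ (A v) w = inner ℂ v (A w)) (hA : ∀ v, A (A v) = v) :
    BinaryMeasurement E where
  effect z := (1 / 2 : ℂ) • (1 + (sign z : ℂ) • A)
  isPositive z := by
    set T : E →L[ℂ] E := (1 / 2 : ℂ) • (1 + (sign z : ℂ) • A)
    have hT : ∀ v w, inner ℂ (T v) w = inner ℂ v (T w) := fun v w => by
      simp [T, hs]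
      ring
    have hTT : ∀ v, T (T v) = T v := fun v => by
      rcases zmod_two_cases z with h | h <;> simp [T, h, hA] <;> module
    refine ⟨hT, fun v => ?_⟩
    rw [ContinuousLinearMap.reApplyInnerSelf_apply, ← hTT, hT]
    exact inner_self_nonneg
  sum_effect := by
    rw [show (Finset.univ : Finset (ZMod 2)) = {0, 1} by decide, Finset.sum_pair (by decide)]
    simp only [sign_zero, sign_one, Complex.ofReal_one, Complex.ofReal_neg]
    module

theorem BinaryMeasurement.isProjective_ofObs {E : Type u} [NormedAddCommGroup E]
    [InnerProductSpace ℂ E] (A : E →L[ℂ] E) (hs : ∀ v w, inner ℂ (A v) w = inner ℂ v (A w))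
    (hA : ∀ v, A (A v) = v) : (ofObs A hs hA).IsProjective := fun z => by
  ext v
  rcases zmod_two_cases z with h | h <;> simp [ofObs, h, hA] <;> module

theorem BinaryMeasurement.obs_ofObs {E : Type u} [NormedAddCommGroup E]
    [InnerProductSpace ℂ E] (A : E →L[ℂ] E) (hs : ∀ v w, inner ℂ (A v) w = inner ℂ v (A w))
    (hA : ∀ v, A (A v) = v) : (ofObs A hs hA).obs = A := by
  rw [obs_eq, ofObs]
  simp only [sign_zero, sign_one, Complex.ofReal_one, Complex.ofReal_neg]
  module

/-- The ensemble that consists of the pure state `ψ`. -/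
def QuantumState.ofVec {K : Type u} [NormedAddCommGroup K] (ψ : K) (hψ : ‖ψ‖ = 1) :
    QuantumState K where
  weight := Pi.single 0 1
  vec _ := ψ
  weight_nonneg l := by
    by_cases h : l = 0
    · subst h; simp
    · simp [h]
  hasSum_weight := hasSum_pi_single 0 1
  norm_vec _ := hψ

theorem QuantumState.isPure_ofVec {K : Type u} [NormedAddCommGroup K] (ψ : K) (hψ : ‖ψ‖ = 1) :
    (ofVec ψ hψ).IsPure := ⟨0, by simp [ofVec]⟩

theorem QuantumState.expect_ofVec {K : Type u} [NormedAddCommGroup K] [InnerProductSpace ℂ K]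
    (ψ : K) (hψ : ‖ψ‖ = 1) (A : K →L[ℂ] K) : (ofVec ψ hψ).expect A = (inner ℂ ψ (A ψ)).re := by
  rw [expect, tsum_eq_single 0 fun l hl => by simp [ofVec, hl]]
  simp [ofVec]

theorem exists_isStandard_performs {k n : ℕ} {E : Type u} [NormedAddCommGroup E]
    [InnerProductSpace ℂ E] [CompleteSpace E] (M : Fin n → ZMod 2 → BinaryMeasurement E)
    (hM : ∀ j s, (M j s).IsProjective) {ψ : HilbertTensor fun _ : Fin n => E} (hψ : ‖ψ‖ = 1)
    {P : Matrix (Fin n) (Fin k) (ZMod 2)} (hP : ∀ j, P j ≠ 0) {f : (Fin k → ZMod 2) → ZMod 2}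
    (h : ∀ x, tensorOp (fun j => (M j (P.mulVec x j)).obs) ψ = (sign (f x) : ℂ) • ψ) :
    ∃ R : NMBQC.{u} k n, R.IsStandard ∧ R.Performs f := by
  refine ⟨{ Space := fun _ => E, state := QuantumState.ofVec ψ hψ, meas := M, P := P, b := 0 },
    ⟨QuantumState.isPure_ofVec ψ hψ, hM, rfl, hP⟩, ?_⟩
  rw [NMBQC.performs_iff]
  intro x
  rw [QuantumState.expect_ofVec]
  simp only [NMBQC.obs, NMBQC.setting, add_zero]
  rw [h, inner_smul_right, Complex.re_ofReal_mul, inner_self_eq_norm_sq_to_K, hψ]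
  simp [sign_mul_self]

/-- The state space of a qubit. -/
abbrev Qubit : Type u := EuclideanSpace ℂ (ULift.{u} Bool)

/-- The computational basis. -/
def ket (i : Bool) : Qubit.{u} := EuclideanSpace.single (ULift.up i) 1

theorem Qubit.inner_eq (v w : Qubit.{u}) :
    inner ℂ v w = conj (v ⟨false⟩) * w ⟨false⟩ + conj (v ⟨true⟩) * w ⟨true⟩ := by
  rw [PiLp.inner_apply, ← Equiv.sum_comp Equiv.ulift.symm, Fintype.sum_bool]
  simp [mul_comm, add_comm]

/-- The phase `exp (∓ i t)`. -/
def phase (t : ℝ) (i : Bool) : ℂ := Complex.exp ((if i then t else -t : ℝ) * Complex.I)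

theorem conj_phase (t : ℝ) (i : Bool) : conj (phase t i) = phase t !i := by
  cases i <;> simp [phase, ← Complex.exp_conj]

theorem phase_mul_phase_not (t : ℝ) (i : Bool) : phase t i * phase t (!i) = 1 := by
  cases i <;> simp [phase, ← Complex.exp_add]

/-- The observable `cos t • X + sin t • Y` of a qubit. -/
def equatorial (t : ℝ) : Qubit.{u} →L[ℂ] Qubit.{u} :=
  LinearMap.toContinuousLinearMap
    { toFun := fun v => WithLp.toLp 2 fun i => phase t i.down * v ⟨!i.down⟩
      map_add' := fun v w => by ext i; simp [mul_add]
      map_smul' := fun a v => by ext i; simp [mul_left_comm] }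

theorem equatorial_apply (t : ℝ) (v : Qubit.{u}) (i : ULift Bool) :
    equatorial t v i = phase t i.down * v ⟨!i.down⟩ := rfl

theorem inner_equatorial_left (t : ℝ) (v w : Qubit.{u}) :
    inner ℂ (equatorial t v) w = inner ℂ v (equatorial t w) := by
  simp only [Qubit.inner_eq, equatorial_apply, map_mul, conj_phase, Bool.not_false, Bool.not_true]
  ring

theorem equatorial_equatorial (t : ℝ) (v : Qubit.{u}) : equatorial t (equatorial t v) = v := by
  ext i
  simp only [equatorial_apply, Bool.not_not]
  rw [← mul_assoc, phase_mul_phase_not, one_mul]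

theorem equatorial_ket (t : ℝ) (i : Bool) :
    equatorial t (ket.{u} i) = phase t (!i) • ket (!i) := by
  ext ⟨l⟩
  rw [equatorial_apply]
  cases i <;> cases l <;> simp [ket]

theorem inner_ket (i l : Bool) : inner ℂ (ket.{u} i) (ket l) = if i = l then 1 else 0 := by
  cases i <;> cases l <;> simp [Qubit.inner_eq, ket]

theorem elem_smul {n : ℕ} {H : Fin n → Type u} [∀ j, NormedAddCommGroup (H j)]
    [∀ j, InnerProductSpace ℂ (H j)] (c : Fin n → ℂ) (v : ∀ j, H j) :
    elem (fun j => c j • v j) = (∏ j, c j) • elem v := by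
  have : (AlgTensor.tprod fun j => c j • v j : AlgTensor H) = (∏ j, c j) • AlgTensor.tprod v :=
    MultilinearMap.map_smul_univ (PiTensorProduct.tprod ℂ (s := H)) c v
  rw [elem, this, UniformSpace.Completion.coe_smul, elem]

/-- The elementary tensor `|i i ⋯ i⟩`. -/
def kets (n : ℕ) (i : Bool) : HilbertTensor fun _ : Fin n => Qubit.{u} := elem fun _ => ket i

theorem tensorOp_equatorial_kets {n : ℕ} (t : Fin n → ℝ) (i : Bool) :
    tensorOp (fun j => equatorial (t j)) (kets.{u} n i) =
      phase (∑ j, t j) (!i) • kets n !i := by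
  rw [kets, tensorOp_elem]
  simp only [equatorial_ket]
  rw [elem_smul, kets]
  congr 1
  cases i <;> simp [phase, ← Complex.exp_sum, Finset.sum_mul]

theorem inner_kets (n : ℕ) (i l : Bool) :
    inner ℂ (kets.{u} n i) (kets n l) = if i = l then 1 else 0 ^ n := by
  rw [kets, kets, inner_elem]
  simp only [inner_ket, Finset.prod_const, Finset.card_univ, Fintype.card_fin]
  split_ifs <;> simp

/-- The state `(|0 ⋯ 0⟩ - |1 ⋯ 1⟩) / √2`. -/
def ghz (n : ℕ) : HilbertTensor fun _ : Fin n => Qubit.{u} :=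
  ((√2)⁻¹ : ℂ) • (kets n false - kets n true)

theorem norm_ghz {n : ℕ} (hn : n ≠ 0) : ‖ghz.{u} n‖ = 1 := by
  have h : ‖kets.{u} n false - kets n true‖ ^ 2 = 2 := by
    rw [norm_sq_eq_re_inner (𝕜 := ℂ)]
    rw [inner_sub_left, inner_sub_right, inner_sub_right]
    simp only [inner_kets, zero_pow hn]
    norm_num
  have h' : ‖kets.{u} n false - kets n true‖ = √2 := by
    rw [← h, Real.sqrt_sq (norm_nonneg _)]
  rw [ghz, norm_smul, h', norm_inv, Complex.norm_real, Real.norm_eq_abs,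
    abs_of_nonneg (Real.sqrt_nonneg 2)]
  exact inv_mul_cancel₀ (by positivity)

theorem phase_pi_mul_val (z : ZMod 2) (i : Bool) : phase (Real.pi * z.val) i = sign z := by
  rcases zmod_two_cases z with rfl | rfl <;> cases i <;>
    simp [phase, ZMod.val_one, Complex.exp_neg]

/-- The operators exchange `|0⋯0⟩` and `|1⋯1⟩` with opposite phases, which coincide at multiples of
`π`. The minus sign in the state supplies the negation that distinguishes NAND from AND. -/
theorem tensorOp_equatorial_ghz {n : ℕ} {t : Fin n → ℝ} {z : ZMod 2}
    (h : ∑ j, t j = Real.pi * z.val) :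
    tensorOp (fun j => equatorial (t j)) (ghz.{u} n) = (sign (z + 1) : ℂ) • ghz n := by
  rw [ghz, map_smul, map_sub, tensorOp_equatorial_kets, tensorOp_equatorial_kets, h,
    phase_pi_mul_val, phase_pi_mul_val, sign_add, sign_one]
  simp only [Bool.not_false, Bool.not_true, Complex.ofReal_mul, Complex.ofReal_neg,
    Complex.ofReal_one]
  module

/-- The angle of the party that receives the XOR `a ⬝ᵥ x`. -/
def angle {k : ℕ} (a : Fin k → ZMod 2) : ℝ := -(sign (a ⬝ᵥ 1) * (2 * Real.pi / 2 ^ k))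

/-- The Fourier expansion of AND: `∑ a, sign (a ⬝ᵥ (1 + x))` is `2 ^ k` if `x = 1` and `0`
otherwise. Writing `val` as `(1 - sign) / 2` halves the coefficient, hence the `2` in `angle`. -/
theorem sum_angle {k : ℕ} (hk : k ≠ 0) (x : Fin k → ZMod 2) :
    ∑ a : Fin k → ZMod 2, angle a * (a ⬝ᵥ x).val = Real.pi * (∏ j, x j).val := by
  have e : ∀ a : Fin k → ZMod 2, angle a * (a ⬝ᵥ x).val =
      (sign (a ⬝ᵥ (1 + x)) - sign (a ⬝ᵥ 1)) * (Real.pi / 2 ^ k) := fun a => by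
    rw [angle, val_eq_sign, dotProduct_add, sign_add]
    ring
  have h1 : (1 : Fin k → ZMod 2) ≠ 0 := fun h =>
    one_ne_zero (congrFun h ⟨0, Nat.pos_of_ne_zero hk⟩)
  simp only [e]
  rw [← Finset.sum_mul, Finset.sum_sub_distrib, sum_sign_dotProduct, sum_sign_dotProduct,
    if_neg h1, sub_zero]
  split_ifs with hx
  · have hx1 : x = 1 := by
      ext j
      have := congrFun hx j
      rcases zmod_two_cases (x j) with h | h
      · simp [h] at this
      · simp [h]
    subst hx1
    simp [ZMod.val_one]
    field_simp
  · obtain ⟨j, hj⟩ := Function.ne_iff.1 hx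
    have hxj : x j = 0 := (zmod_two_cases (x j)).resolve_right fun h => hj (by
      rw [Pi.add_apply, h, Pi.one_apply, Pi.zero_apply]; decide)
    rw [Finset.prod_eq_zero (Finset.mem_univ j) hxj]
    simp

theorem exists_isStandard_performs_nand (k : ℕ) :
    ∃ R : NMBQC.{u} k (2 ^ k - 1), R.IsStandard ∧ R.Performs (nand k) := by
  rcases eq_or_ne k 0 with rfl | hk
  -- For `k = 0` the function is the constant `0`, the parity of no outcomes. The GHZ vector
  -- vanishes for `n = 0`, so the empty product vector is used.
  · refine exists_isStandard_performs (E := Qubit.{u}) (n := 0) (fun j => j.elim0)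
      (fun j => j.elim0) (ψ := kets 0 false) ?_ (P := 0) (fun j => j.elim0) fun x => ?_
    · rw [norm_eq_sqrt_re_inner (𝕜 := ℂ), inner_kets]; simp
    · have h1 : nand 0 x = 0 := by
        rw [nand, Finset.univ_eq_empty, Finset.prod_empty]; decide
      rw [h1, kets, tensorOp_elem, sign_zero, Complex.ofReal_one, one_smul]
      congr 1
      ext1 j
      exact j.elim0
  · have hcard : Fintype.card {a : Fin k → ZMod 2 // a ≠ 0} = 2 ^ k - 1 := by
      rw [Fintype.card_subtype_compl]
      simp
    have hn : 2 ^ k - 1 ≠ 0 := by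
      have := Nat.one_lt_two_pow hk
      omega
    let e := (Fintype.equivFinOfCardEq hcard).symm
    refine exists_isStandard_performs
      (fun j s => BinaryMeasurement.ofObs (equatorial.{u} (angle (e j).1 * s.val))
        (inner_equatorial_left _) (equatorial_equatorial _))
      (fun j s => BinaryMeasurement.isProjective_ofObs _ _ _) (norm_ghz hn)
      (P := fun j => (e j).1) (fun j => (e j).2) fun x => ?_
    simp only [BinaryMeasurement.obs_ofObs]
    refine tensorOp_equatorial_ghz ?_
    rw [← sum_angle hk]
    -- The party for `a = 0` would always receive `0` and add no angle; dropping it leaves `2 ^ k -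
    -- 1` parties.
    have h : ∑ a : Fin k → ZMod 2 with a ≠ 0, angle a * ((a ⬝ᵥ x).val : ℝ) =
        ∑ a : Fin k → ZMod 2, angle a * ((a ⬝ᵥ x).val : ℝ) := by
      refine Finset.sum_filter_of_ne fun a _ ha => ?_
      rintro rfl
      exact ha (by simp)
    refine Eq.trans ?_ h
    refine (Fintype.sum_equiv e _ (fun a => angle a.1 * ((a.1 ⬝ᵥ x).val : ℝ)) fun _ => rfl).trans ?_
    exact (Finset.sum_subtype (Finset.univ.filter fun a : Fin k → ZMod 2 => a ≠ 0) (by simp)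
      fun a => angle a * ((a ⬝ᵥ x).val : ℝ)).symm

end MBQC

end

/-- With `2 ^ k - 1` parties the `k`-bit NAND function can be performed deterministically,
already with a pure state, von Neumann measurements and settings `P x`; with fewer parties it
cannot be, whatever the state, the measurements and the settings `P x ⊕ b`. -/
theorem theorem3p4p2 (k : ℕ) :
    (∃ R : MBQC.NMBQC.{u} k (2 ^ k - 1), R.IsStandard ∧ R.Performs (MBQC.nand k)) ∧
      ∀ n : ℕ, n < 2 ^ k - 1 → ∀ R : MBQC.NMBQC.{u} k n, ¬ R.Performs (MBQC.nand k) := by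
  exact ⟨MBQC.exists_isStandard_performs_nand k, fun _ hn R h =>
    absurd (R.card_le_of_performs_nand h) (not_le.2 hn)⟩
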